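/- **Notation.** Let $s\ge 2$. For $1\le r\le s$ and $u\in\mathbb{Z}_{2^r}$ with binary expansion $u=\sum_{i=0}^{r-1}u_i2^i$, let $\phi_r(u)=(u_{r-1},\dots,u_{r-1})+(u_0,\dots,u_{r-2})Y_{r-1}\in\mathbb{Z}_2^{2^{r-1}}$ (Carlet's Gray map), where the columns of $Y_{r-1}$ are all the vectors of $\mathbb{Z}_2^{r-1}$, ordered as the binary expansions of $0,1,\dots,2^{r-1}-1$. Let $\Phi:\mathbb{Z}_2^{\alpha_1}\times\mathbb{Z}_4^{\alpha_2}\times\dots\times\mathbb{Z}_{2^s}^{\alpha_s}\to\mathbb{Z}_2^{\alpha_1+2\alpha_2+\dots+2^{s-1}\alpha_s}$ be the map that applies $\phi_r$ to every coordinate over $\mathbb{Z}_{2^r}$, for $r=1,\dots,s$. In matrices, $\mathbf{a}$ denotes a constant row vector with all entries $a$. For integers $t_1\ge1$, $t_2,\dots,t_{s-1}\ge0$, $t_s\ge1$ the matrix $A_2^{t_1,\dots,t_s}=(A_1\mid\dots\mid A_s)$, with $A_r$ over $\mathbb{Z}_{2^r}$, is built as follows. The matrix $A_2^{1,0,\dots,0,1}$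 has $A_1=\begin{pmatrix}1&1\\0&1\end{pmatrix}$ and $A_r=\begin{pmatrix}2^{r-1}\\1\end{pmatrix}$ for $2\le r\le s$. For $1\le i\le s$, let step $i$ be the operation that sends a matrix $(A_1\mid\dots\mid A_s)$ with $m$ rows to the matrix $(A_1'\mid\dots\mid A_s')$ with $m+1$ rows given by - $A_1'=\begin{pmatrix}A_1&A_1\\ \mathbf 0&\mathbf 1\end{pmatrix}$; - $A_r'=\begin{pmatrix}M_{r-1}&A_r&A_r&\cdots&A_r\\ \mathbf 1&\mathbf 0&\mathbf 1&\cdots&\mathbf{2^r-1}\end{pmatrix}$ for $2\le r\le s-i+1$, where the columns of $M_{r-1}$ are all the vectors with first entry $2^{r-1}$ and the other $m-1$ entries in $\{0,2,4,\dots,2(2^{r-1}-1)\}\subset\mathbb{Z}_{2^r}$, each taken once; - $A_r'=\begin{pmatrix}A_r&A_r&\cdots&A_r\\ 2^k\cdot\mathbf 0&2^k\cdot\mathbf 1&\cdots&2^k\cdot(\mathbf{2^{s-i+1}-1})\end{pmatrix}$ with $k=r-(s-i+1)$, for $s-i+1<r\le s$ and $r\geq 2$. Starting from $A_2^{1,0,\dots,0,1}$,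 apply step $1$ exactly $t_1-1$ times, then step $i$ exactly $t_i$ times for $i=2,\dots,s-1$ in this order, and finally step $s$ exactly $t_s-1$ times; the result is $A_2^{t_1,\dots,t_s}$. Let $\mathcal{H}_2^{t_1,\dots,t_s}$ be the additive group generated by its rows, and let $H_2^{t_1,\dots,t_s}=\Phi(\mathcal{H}_2^{t_1,\dots,t_s})$, a binary code. **Theorem.** Let $s\ge2$, $t_1\ge1$, $t_2,\dots,t_{s-1}\ge0$ and $t_s\ge1$ be integers. The code $H_2^{t_1,\dots,t_s}$ is linear over $\mathbb{Z}_2$ (that is, a linear subspace) if and only if $t_1=1$ and $t_2=\dots=t_{s-1}=0$. In other words, among the codes $H_2^{t_1,\dots,t_s}$, the codes $H_2^{1,0,\dots,0,t_s}$ with $t_s\ge1$ are linear, and all the others are nonlinear. -/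

import Mathlib

/-- A generator matrix `(A₁ | A₂ | ⋯)` with `rows` rows whose `r`-th block is a matrix over
`ℤ / p ^ r`. Block `r` is the list of its columns from left to right; a column is a function of the
row index, so its top entry is the value at `0`. Only the blocks `1 ≤ r ≤ s` are used for codes over
`ℤ_p, ℤ_{p²}, …, ℤ_{p^s}`. -/
structure GenMatrix (p : ℕ) where
  rows : ℕ
  block : (r : ℕ) → List (Fin rows → ZMod (p ^ r))

namespace GenMatrix

/-- For a list of columns `B` and `xs = [x₁, …, xₖ]` this is the block
`(B ⋯ B)` above the new bottom row `(𝐱₁ ⋯ 𝐱ₖ)`: one copy of `B` for each `xᵢ`, with the constant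
vector `𝐱ᵢ` written below it. -/
def appendRow {R : Type} {m : ℕ} (B : List (Fin m → R)) (xs : List R) :
    List (Fin (m + 1) → R) :=
  xs.flatMap fun x => B.map fun c => Fin.snoc (α := fun _ => R) c x

/-- All columns with `m ≥ 1` entries whose top entry is `x` and whose other entries run through
`l`, in lexicographic order: the columns `zᵀ` with `z ∈ {x} × l × ⋯ × l`. -/
def tuples {R : Type} (x : R) (l : List R) : (m : ℕ) → List (Fin m → R)
  | 0 => []
  | 1 => [fun _ => x]
  | m + 2 => (tuples x l (m + 1)).flatMap fun c => l.map fun y => Fin.snoc (α := fun _ => R) c y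

/-- The matrix `M_j` over `ℤ / p ^ (j + 1)` (here `r = j + 1 ≥ 2`) with `m` rows: its columns are the
`zᵀ` with `z ∈ {p ^ j} × {p * 0, p * 1, …, p * (p ^ j - 1)} ^ (m - 1)`. -/
def blockM (p r m : ℕ) : List (Fin m → ZMod (p ^ r)) :=
  tuples ((p : ZMod (p ^ r)) ^ (r - 1))
    ((List.range (p ^ (r - 1))).map fun a => (p : ZMod (p ^ r)) * (a : ZMod (p ^ r))) m

/-- The matrix `A_p^{1,0,…,0,1}`. Its block over `ℤ_p` has the columns `(1, a)ᵀ`, `0 ≤ a ≤ p - 1`,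
and for `2 ≤ r ≤ s` its block over `ℤ / p ^ r` has the columns `(p ^ (r - 1), a)ᵀ`,
`1 ≤ a ≤ p - 1`. -/
def base (p s : ℕ) : GenMatrix p where
  rows := 2
  block r :=
    if r = 1 then (List.range p).map fun a => ![1, (a : ZMod (p ^ r))]
    else if 2 ≤ r ∧ r ≤ s then
      (List.range' 1 (p - 1)).map fun a => ![(p : ZMod (p ^ r)) ^ (r - 1), (a : ZMod (p ^ r))]
    else []

/-- The construction that adds one row of order `p ^ (s - i + 1)` at the bottom, for `1 ≤ i ≤ s`.
It sends `(A₁ | ⋯ | A_s)` to the matrix with the blocks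
* `r = 1`: `A₁ ⋯ A₁` above `𝟎 ⋯ 𝐩-𝟏`;
* `2 ≤ r ≤ s - i + 1` (the matrix `P_{r-1}`): `M_{r-1} ⋯ M_{r-1}` above `𝟏 ⋯ 𝐩-𝟏`, followed by
  `A_r ⋯ A_r` above `𝟎 ⋯ 𝐩^𝐫-𝟏`;
* `s - i + 1 < r ≤ s` (the matrix `Q_k` with `k = r - (s - i + 1)`): `A_r ⋯ A_r` above
  `p ^ k * c` for `c = 0, …, p ^ (s - i + 1) - 1`. -/
def step (p s i : ℕ) (A : GenMatrix p) : GenMatrix p where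
  rows := A.rows + 1
  block r :=
    if r = 1 then
      appendRow (A.block r) ((List.range p).map fun a => (a : ZMod (p ^ r)))
    else if 2 ≤ r ∧ r ≤ s - i + 1 then
      appendRow (blockM p r A.rows) ((List.range' 1 (p - 1)).map fun a => (a : ZMod (p ^ r))) ++
        appendRow (A.block r) ((List.range (p ^ r)).map fun a => (a : ZMod (p ^ r)))
    else if s - i + 1 < r ∧ r ≤ s then
      appendRow (A.block r) ((List.range (p ^ (s - i + 1))).map fun c =>
        (p : ZMod (p ^ r)) ^ (r - (s - i + 1)) * (c : ZMod (p ^ r)))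
    else []

/-- The number of times that the construction `step p s i` is applied on the way from
`A_p^{1,0,…,0,1}` to `A_p^{t₁,…,t_s}`, where `t₁, t_s ≥ 1` and `s ≥ 2`. -/
def numSteps (s : ℕ) (t : ℕ → ℕ) (i : ℕ) : ℕ :=
  if i = 1 ∨ i = s then t i - 1 else t i

/-- The matrix `A_p^{t₁,…,t_s}` (with `t₁, t_s ≥ 1` and `s ≥ 2`): starting from `A_p^{1,0,…,0,1}`,
first add `t₁ - 1` rows with `i = 1`, then `t₂` rows with `i = 2`, and so on up to `t_{s-1}` rows
with `i = s - 1`, and finally `t_s - 1` rows with `i = s`. -/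
def ofType (p s : ℕ) (t : ℕ → ℕ) : GenMatrix p :=
  (List.range' 1 s).foldl (fun A i => (step p s i)^[numSteps s t i] A) (base p s)

/-- The group `ℤ_p^{α₁} × ℤ_{p²}^{α₂} × ⋯ × ℤ_{p^s}^{α_s}`, where `α_r` is the number of columns of
block `r` of `A`. -/
abbrev Word {p : ℕ} (A : GenMatrix p) (s : ℕ) : Type :=
  (r : Finset.Icc 1 s) → Fin (A.block r).length → ZMod (p ^ (r : ℕ))

/-- The `k`-th row of the blocks `1, …, s` of `A`. -/
def row {p : ℕ} (A : GenMatrix p) (s : ℕ) (k : Fin A.rows) : A.Word s :=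
  fun r j => (A.block r).get j k

/-- The additive code generated by the rows of `(A₁ | ⋯ | A_s)`. -/
def additiveCode {p : ℕ} (A : GenMatrix p) (s : ℕ) : AddSubgroup (A.Word s) :=
  AddSubgroup.closure (Set.range (A.row s))

end GenMatrix

/-- The `i`-th digit of the `p`-ary expansion of `n`, as an element of `ℤ_p`. -/
def digit (p n i : ℕ) : ZMod p := ((n / p ^ i % p : ℕ) : ZMod p)

/-- The Gray map `φ_r : ℤ / p ^ r → ℤ_p ^ (p ^ (r - 1))`,
`φ_r(u) = (u_{r-1}, …, u_{r-1}) + (u_0, …, u_{r-2}) Y_{r-1}`, where the `u_i` are the `p`-ary digits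
of `u` and column `y` of `Y_{r-1}` consists of the digits `y_0, …, y_{r-2}` of `y`. -/
def gray (p r : ℕ) (u : ZMod (p ^ r)) (y : Fin (p ^ (r - 1))) : ZMod p :=
  digit p u.val (r - 1) + ∑ i ∈ Finset.range (r - 1), digit p u.val i * digit p y i

/-- The set of coordinates of the Gray image of a word: for each block `r` and each of the `α_r`
coordinates of that block, `p ^ (r - 1)` coordinates over `ℤ_p`. -/
abbrev GenMatrix.Coord {p : ℕ} (A : GenMatrix p) (s : ℕ) : Type :=
  (r : Finset.Icc 1 s) × (Fin (A.block r).length × Fin (p ^ ((r : ℕ) - 1)))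

/-- The Gray map `Φ(y₁ | y₂ | ⋯ | y_s) = (y₁, Φ₂(y₂), …, Φ_s(y_s))`, that is, `φ_r` on every
coordinate of block `r`. -/
def GenMatrix.grayMap {p : ℕ} (A : GenMatrix p) (s : ℕ) (x : A.Word s) : A.Coord s → ZMod p :=
  fun q => gray p q.1 (x q.1 q.2.1) q.2.2

/-- The code `H_p^{t₁,…,t_s}` over `ℤ_p`: the Gray image of the additive code generated by
`A_p^{t₁,…,t_s}`. -/
def codeH (p s : ℕ) (t : ℕ → ℕ) : Set ((GenMatrix.ofType p s t).Coord s → ZMod p) :=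
  (GenMatrix.ofType p s t).grayMap s '' ((GenMatrix.ofType p s t).additiveCode s : Set _)

/-- A code over `ℤ_p` is linear if it is a linear subspace. -/
def IsLinearCode {p : ℕ} {ι : Type} (C : Set (ι → ZMod p)) : Prop :=
  ∃ V : Submodule (ZMod p) (ι → ZMod p), (V : Set (ι → ZMod p)) = C

/-!
The Gray map is additive when one of the summands has its coordinates over `ℤ / p ^ r` in the
subgroup generated by `p ^ (r - 1)`. If `p = 2` and only steps `i ≥ s` occur, all rows but the
second have this property, and the second row `e` has entries `0` and `1`. So
`Φ(m e) + Φ(n e) = Φ(k e)`, where the digits of `k` are the sums without carry of those of `m` and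
`n`, and the code is linear.

In all other cases there are columns `b`, `c`, `d` over `ℤ / p ^ 2` such that `b + d - c` is `p` in
the first row and `0` in the others, that is, `p` times a column over `ℤ_p`. This relation passes to
all codewords. If the code is linear, it contains a codeword with Gray image `Φ(x) + Φ((p - 1) y)`,
where `x` and `y` are suitable rows other than the first. Reading off the entries of that codeword
by injectivity of the Gray map, one sees that the relation gives `p = 0` in `ℤ / p ^ 2`.
-/

section Residues

theorem mem_zmultiples_one {n : ℕ} (x : ZMod n) : x ∈ AddSubgroup.zmultiples 1 := by
  obtain ⟨k, rfl⟩ := ZMod.intCast_surjective x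
  exact AddSubgroup.intCast_mem_zmultiples_one k

theorem natCast_zmod_sq_ne_zero {p : ℕ} (hp : 2 ≤ p) : (p : ZMod (p ^ 2)) ≠ 0 := by
  rw [Ne, ZMod.natCast_eq_zero_iff]
  exact fun h => (Nat.le_of_dvd (by omega) h).not_gt (lt_self_pow₀ hp one_lt_two)

theorem exists_addMonoidHom_one_eq {n : ℕ} {G : Type} [AddGroup G] {x : G} (hx : n • x = 0) :
    ∃ ψ : ZMod n →+ G, ψ 1 = x := by
  let φ : {φ : ℤ →+ G // φ n = 0} := ⟨zmultiplesHom G x, by simpa using hx⟩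
  refine ⟨ZMod.lift n φ, ?_⟩
  simpa [φ] using ZMod.lift_coe n φ 1

end Residues

section Digits

variable {p : ℕ}

theorem digit_eq_natCast_finFunctionFinEquiv_symm {r : ℕ} (n : Fin (p ^ r)) (i : Fin r) :
    digit p n i = ((finFunctionFinEquiv.symm n i : Fin p) : ℕ) :=
  rfl

theorem exists_lt_digit_eq [NeZero p] (r : ℕ) (f : ℕ → ZMod p) :
    ∃ n < p ^ r, ∀ i < r, digit p n i = f i := by
  let n : Fin (p ^ r) := finFunctionFinEquiv fun i => ⟨(f i).val, ZMod.val_lt _⟩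
  refine ⟨n, n.2, fun i hi => ?_⟩
  rw [digit_eq_natCast_finFunctionFinEquiv_symm n ⟨i, hi⟩, Equiv.symm_apply_apply,
    ZMod.natCast_zmod_val]

theorem eq_of_digit_eq {r m n : ℕ} (hm : m < p ^ r) (hn : n < p ^ r)
    (h : ∀ i < r, digit p m i = digit p n i) : m = n := by
  suffices (⟨m, hm⟩ : Fin (p ^ r)) = ⟨n, hn⟩ from congrArg Fin.val this
  refine finFunctionFinEquiv.symm.injective (funext fun i => Fin.ext ?_)
  have hi := h i i.2
  rwa [digit_eq_natCast_finFunctionFinEquiv_symm ⟨m, hm⟩,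
    digit_eq_natCast_finFunctionFinEquiv_symm ⟨n, hn⟩, ZMod.natCast_eq_natCast_iff',
    Nat.mod_eq_of_lt (Fin.is_lt _), Nat.mod_eq_of_lt (Fin.is_lt _)] at hi

theorem digit_mod_pow {r i : ℕ} (hi : i < r) (n : ℕ) : digit p (n % p ^ r) i = digit p n i := by
  obtain ⟨d, rfl⟩ := Nat.exists_eq_add_of_lt hi
  rw [digit, digit, show p ^ (i + d + 1) = p ^ i * (p * p ^ d) by ring,
    Nat.mod_mul_right_div_self, Nat.mod_mul_right_mod]

end Digits

section Gray

variable {p r : ℕ}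

theorem gray_zero (y : Fin (p ^ (r - 1))) : gray p r 0 y = 0 := by
  simp [gray, digit]

theorem gray_natCast (hr : 1 ≤ r) (n : ℕ) (y : Fin (p ^ (r - 1))) :
    gray p r n y =
      digit p n (r - 1) + ∑ i ∈ Finset.range (r - 1), digit p n i * digit p y i := by
  have hdigit : ∀ i < r, digit p (n : ZMod (p ^ r)).val i = digit p n i := fun i hi => by
    rw [ZMod.val_natCast, digit_mod_pow hi]
  rw [gray, hdigit _ (by omega)]
  congr 1
  refine Finset.sum_congr rfl fun i hi => ?_
  rw [hdigit i (by have := Finset.mem_range.1 hi; omega)]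

theorem gray_natCast_add_of_digit_eq_add (hr : 1 ≤ r) {k m n : ℕ}
    (h : ∀ i < r, digit p k i = digit p m i + digit p n i) (y : Fin (p ^ (r - 1))) :
    gray p r k y = gray p r m y + gray p r n y := by
  have hsum : ∑ i ∈ Finset.range (r - 1), digit p k i * digit p y i =
      ∑ i ∈ Finset.range (r - 1), (digit p m i + digit p n i) * digit p y i :=
    Finset.sum_congr rfl fun i hi => by rw [h i (by have := Finset.mem_range.1 hi; omega)]
  simp only [gray_natCast hr, h (r - 1) (by omega), hsum, add_mul, Finset.sum_add_distrib]
  ring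

theorem gray_two_natCast {a : ℕ} (ha : a < p) (b : ℕ) (y : Fin (p ^ (2 - 1))) :
    gray p 2 ((a + p * b : ℕ) : ZMod (p ^ 2)) y = b + a * digit p y 0 := by
  have h1 : digit p (a + p * b) 1 = b := by
    simp [digit, Nat.add_mul_div_left _ _ (by omega : 0 < p), Nat.div_eq_of_lt ha]
  have h0 : digit p (a + p * b) 0 = a := by
    simp [digit]
  rw [gray_natCast one_le_two]
  simp [h0, h1]

variable [NeZero p]

theorem gray_injective : Function.Injective (gray p r) := by
  intro u v huv
  have hgray := congrFun huv
  simp only [gray] at hgray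
  have htop : digit p u.val (r - 1) = digit p v.val (r - 1) := by
    simpa [digit] using hgray ⟨0, NeZero.pos _⟩
  have hlow : ∀ i < r - 1, digit p u.val i = digit p v.val i := by
    intro i hi
    obtain ⟨y, hy, hdigit⟩ := exists_lt_digit_eq (r - 1) (Pi.single i (1 : ZMod p))
    have hsum : ∀ n, ∑ j ∈ Finset.range (r - 1), digit p n j * digit p y j = digit p n i := by
      intro n
      rw [Finset.sum_eq_single_of_mem i (Finset.mem_range.2 hi) fun j hj hji => by
        rw [hdigit j (Finset.mem_range.1 hj), Pi.single_eq_of_ne hji, mul_zero],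
        hdigit i hi, Pi.single_eq_same, mul_one]
    have hy' := hgray ⟨y, hy⟩
    rw [hsum, hsum, htop] at hy'
    exact add_left_cancel hy'
  refine ZMod.val_injective _ (eq_of_digit_eq (ZMod.val_lt u) (ZMod.val_lt v) fun i hi => ?_)
  rcases (Nat.le_sub_one_of_lt hi).eq_or_lt with rfl | hi
  exacts [htop, hlow i hi]

theorem gray_add_natCast_mul_pow (hr : 1 ≤ r) (u : ZMod (p ^ r)) (a : ℕ)
    (y : Fin (p ^ (r - 1))) :
    gray p r (u + a * (p : ZMod (p ^ r)) ^ (r - 1)) y = gray p r u y + a := by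
  obtain ⟨n, rfl⟩ := ZMod.natCast_zmod_surjective u
  have htop : digit p (n + a * p ^ (r - 1)) (r - 1) = digit p n (r - 1) + a := by
    simp [digit, Nat.add_mul_div_right _ _ (NeZero.pos (p ^ (r - 1)))]
  have hlow : ∀ i ∈ Finset.range (r - 1), digit p (n + a * p ^ (r - 1)) i = digit p n i := by
    intro i hi
    rw [← digit_mod_pow (Finset.mem_range.1 hi), Nat.add_mul_mod_self_right,
      digit_mod_pow (Finset.mem_range.1 hi)]
  have hcast : (n : ZMod (p ^ r)) + a * (p : ZMod (p ^ r)) ^ (r - 1) =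
      ((n + a * p ^ (r - 1) : ℕ) : ZMod (p ^ r)) := by
    push_cast
    rfl
  rw [hcast, gray_natCast hr, gray_natCast hr, htop,
    Finset.sum_congr rfl fun i hi => by rw [hlow i hi]]
  ring

theorem gray_add_of_mem_zmultiples (hr : 1 ≤ r) (u : ZMod (p ^ r)) {v : ZMod (p ^ r)}
    (hv : v ∈ AddSubgroup.zmultiples ((p : ZMod (p ^ r)) ^ (r - 1))) (y : Fin (p ^ (r - 1))) :
    gray p r (u + v) y = gray p r u y + gray p r v y := by
  obtain ⟨a, rfl⟩ := mem_multiples_iff_mem_zmultiples.2 hv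
  have hv' := gray_add_natCast_mul_pow hr 0 a y
  rw [zero_add, gray_zero, zero_add] at hv'
  simp only [nsmul_eq_mul]
  rw [gray_add_natCast_mul_pow hr, hv']

end Gray

section GrayTwo

variable {p : ℕ}

theorem gray_two_one_add_gray_two_sub_one (hp : 2 ≤ p) :
    gray p 2 1 + gray p 2 ((p - 1 : ℕ) : ZMod (p ^ 2)) = 0 := by
  funext y
  have h1 := gray_two_natCast hp 0 y
  have h2 := gray_two_natCast (by omega : p - 1 < p) 0 y
  simp only [mul_zero, add_zero, Nat.cast_one] at h1 h2
  rw [Pi.add_apply, h1, h2, Nat.cast_sub (by omega)]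
  simp

theorem gray_two_two_add_gray_two_mul_two (hp : 3 ≤ p) :
    gray p 2 2 + gray p 2 (((p - 1 : ℕ) : ZMod (p ^ 2)) * 2) = gray p 2 p := by
  funext y
  have htwo := gray_two_natCast (by omega : 2 < p) 0 y
  have hdouble := gray_two_natCast (by omega : p - 2 < p) 1 y
  have hp' := gray_two_natCast (by omega : 0 < p) 1 y
  rw [show p - 2 + p * 1 = (p - 1) * 2 by omega, Nat.cast_sub (by omega : 2 ≤ p)] at hdouble
  push_cast at htwo hdouble hp'
  simp only [mul_zero, add_zero, zero_add, mul_one, zero_mul] at htwo hp'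
  rw [Pi.add_apply, htwo, hdouble, hp', CharP.cast_eq_zero]
  ring

theorem gray_two_eq_zero_iff [NeZero p] {z : ZMod (p ^ 2)} : gray p 2 z = 0 ↔ z = 0 := by
  have hzero : gray p 2 0 = 0 := funext gray_zero
  rw [← hzero, gray_injective.eq_iff]

end GrayTwo

theorem isLinearCode_of_zero_mem_of_add_mem {p : ℕ} [NeZero p] {ι : Type}
    {C : Set (ι → ZMod p)} (h0 : 0 ∈ C) (hadd : ∀ x ∈ C, ∀ y ∈ C, x + y ∈ C) :
    IsLinearCode C := by
  let M : AddSubmonoid (ι → ZMod p) := ⟨⟨C, fun hx hy => hadd _ hx _ hy⟩, h0⟩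
  refine ⟨{ M with smul_mem' := fun a x hx => ?_ }, rfl⟩
  obtain ⟨n, rfl⟩ := ZMod.natCast_zmod_surjective a
  rw [Nat.cast_smul_eq_nsmul]
  exact M.nsmul_mem hx n

namespace GenMatrix

section Columns

variable {R : Type} [AddZeroClass R] {m : ℕ}

/-- The columns of a block, extended by zero below the last row. A column keeps its meaning when
rows are added, because the type `ℕ → R` does not depend on their number. -/
def columns (B : List (Fin m → R)) : Set (ℕ → R) :=
  {f | ∃ c ∈ B, Function.extend Fin.val c 0 = f}

theorem extend_val_of_le (c : Fin m → R) {k : ℕ} (hk : m ≤ k) :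
    Function.extend Fin.val c 0 k = 0 :=
  Function.extend_apply' _ _ _ fun ⟨a, ha⟩ => (a.2.trans_le hk).ne ha

theorem extend_snoc (c : Fin m → R) (x : R) :
    Function.extend Fin.val (Fin.snoc (α := fun _ => R) c x : Fin (m + 1) → R) 0 =
      Function.extend Fin.val c 0 + Pi.single m x := by
  funext k
  rcases lt_trichotomy k m with hk | rfl | hk
  · have hc := Fin.val_injective.extend_apply c 0 ⟨k, hk⟩
    have hsnoc := Fin.val_injective.extend_apply
      (Fin.snoc (α := fun _ => R) c x : Fin (m + 1) → R) 0 (Fin.castSucc ⟨k, hk⟩)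
    rw [Fin.snoc_castSucc] at hsnoc
    rw [Pi.add_apply, Pi.single_eq_of_ne hk.ne, add_zero]
    exact hsnoc.trans hc.symm
  · have hsnoc := Fin.val_injective.extend_apply
      (Fin.snoc (α := fun _ => R) c x : Fin (k + 1) → R) 0 (Fin.last k)
    rw [Fin.snoc_last] at hsnoc
    rw [Pi.add_apply, Pi.single_eq_same, extend_val_of_le c le_rfl, zero_add]
    exact hsnoc
  · rw [Pi.add_apply, Pi.single_eq_of_ne hk.ne', extend_val_of_le _ (Nat.succ_le_of_lt hk),
      extend_val_of_le c hk.le, add_zero]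

theorem extend_const (x : R) :
    Function.extend Fin.val (fun _ : Fin 1 => x) 0 = Pi.single 0 x := by
  funext k
  rcases k with _ | k
  · exact Fin.val_injective.extend_apply _ _ 0
  · rw [extend_val_of_le _ k.succ_pos, Pi.single_eq_of_ne k.succ_ne_zero]

theorem extend_vec_two (x y : R) :
    Function.extend Fin.val ![x, y] 0 = Pi.single 0 x + Pi.single 1 y := by
  rw [← extend_const, ← extend_snoc]
  congr
  funext i
  fin_cases i <;> rfl

theorem mem_columns_map_vec_two {x : R} {l : List R} {f : ℕ → R} :
    f ∈ columns (l.map fun y => ![x, y]) ↔ ∃ y ∈ l, Pi.single 0 x + Pi.single 1 y = f := by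
  simp [columns, extend_vec_two]

theorem mem_columns_appendRow {B : List (Fin m → R)} {xs : List R} {f : ℕ → R} :
    f ∈ columns (appendRow B xs) ↔ ∃ x ∈ xs, ∃ g ∈ columns B, g + Pi.single m x = f := by
  simp [columns, appendRow, extend_snoc]

theorem columns_append (B B' : List (Fin m → R)) :
    columns (B ++ B') = columns B ∪ columns B' := by
  ext f
  simp [columns, or_and_right, exists_or]

theorem single_mem_columns_tuples (x : R) {l : List R} (hl : 0 ∈ l) (hm : m ≠ 0) :
    Pi.single 0 x ∈ columns (tuples x l m) := by
  obtain ⟨m, rfl⟩ := Nat.exists_eq_succ_of_ne_zero hm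
  induction m with
  | zero => exact ⟨_, List.mem_singleton_self _, extend_const x⟩
  | succ m ih =>
    obtain ⟨c, hc, hcx⟩ := ih m.succ_ne_zero
    refine ⟨_, List.mem_flatMap.2 ⟨c, hc, List.mem_map_of_mem hl⟩, ?_⟩
    rw [extend_snoc, hcx, Pi.single_zero, add_zero]

end Columns

section Blocks

variable {p s r : ℕ} {A : GenMatrix p}

theorem exists_row_eq_of_mem_columns {f : ℕ → ZMod (p ^ r)} (hf : f ∈ columns (A.block r))
    (hr : r ∈ Finset.Icc 1 s) : ∃ j, ∀ k : Fin A.rows, A.row s k ⟨r, hr⟩ j = f k := by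
  obtain ⟨c, hc, rfl⟩ := hf
  obtain ⟨j, rfl⟩ := List.get_of_mem hc
  exact ⟨j, fun k => (Fin.val_injective.extend_apply _ _ k).symm⟩

theorem row_mem_columns (r : Finset.Icc 1 s) (j : Fin (A.block r).length) :
    ∃ f ∈ columns (A.block r), ∀ k : Fin A.rows, A.row s k r j = f k :=
  ⟨_, ⟨_, List.get_mem _ _, rfl⟩, fun k => (Fin.val_injective.extend_apply _ _ k).symm⟩

end Blocks

section StepColumns

variable {p s i r : ℕ} {A : GenMatrix p}

theorem mem_columns_base_one {f : ℕ → ZMod (p ^ 1)} :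
    f ∈ columns ((base p s).block 1) ↔
      ∃ a < p, Pi.single 0 1 + Pi.single 1 (a : ZMod (p ^ 1)) = f := by
  have hblock : (base p s).block 1 = (List.range p).map fun a => ![1, (a : ZMod (p ^ 1))] := rfl
  rw [hblock]
  exact mem_columns_map_vec_two.trans (by simp)

theorem mem_columns_base (hr : 2 ≤ r) (hrs : r ≤ s) {f : ℕ → ZMod (p ^ r)} :
    f ∈ columns ((base p s).block r) ↔ ∃ a, (1 ≤ a ∧ a < p) ∧
      Pi.single 0 ((p : ZMod (p ^ r)) ^ (r - 1)) + Pi.single 1 (a : ZMod (p ^ r)) = f := by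
  have hblock : (base p s).block r =
      (List.range' 1 (p - 1)).map fun a => ![(p : ZMod (p ^ r)) ^ (r - 1), (a : ZMod (p ^ r))] :=
    (if_neg (by omega)).trans (if_pos ⟨hr, hrs⟩)
  have hlt (a : ℕ) : 1 ≤ a ∧ a < p ↔ 1 ≤ a ∧ a < 1 + (p - 1) := by omega
  rw [hblock]
  exact mem_columns_map_vec_two.trans (by simp [hlt])

theorem mem_columns_step_one {f : ℕ → ZMod (p ^ 1)} :
    f ∈ columns ((step p s i A).block 1) ↔
      ∃ a < p, ∃ g ∈ columns (A.block 1), g + Pi.single A.rows (a : ZMod (p ^ 1)) = f := by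
  have hblock : (step p s i A).block 1 =
      appendRow (A.block 1) ((List.range p).map fun a => (a : ZMod (p ^ 1))) := rfl
  rw [hblock]
  exact mem_columns_appendRow.trans (by simp)

theorem mem_columns_step_of_le [NeZero p] (hr : 2 ≤ r) (hri : r ≤ s - i + 1)
    {f : ℕ → ZMod (p ^ r)} :
    f ∈ columns ((step p s i A).block r) ↔
      (∃ a, (1 ≤ a ∧ a < p) ∧ ∃ g ∈ columns (blockM p r A.rows),
        g + Pi.single A.rows (a : ZMod (p ^ r)) = f) ∨
      ∃ x, ∃ g ∈ columns (A.block r), g + Pi.single A.rows x = f := by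
  have hblock : (step p s i A).block r =
      appendRow (blockM p r A.rows) ((List.range' 1 (p - 1)).map fun a => (a : ZMod (p ^ r))) ++
        appendRow (A.block r) ((List.range (p ^ r)).map fun a => (a : ZMod (p ^ r))) :=
    (if_neg (by omega)).trans (if_pos ⟨hr, hri⟩)
  have hlt (a : ℕ) : 1 ≤ a ∧ a < p ↔ 1 ≤ a ∧ a < 1 + (p - 1) := by omega
  have hrange (x : ZMod (p ^ r)) : ∃ a < p ^ r, x = a :=
    ⟨x.val, ZMod.val_lt x, (ZMod.natCast_zmod_val x).symm⟩
  rw [hblock]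
  refine (Set.ext_iff.1 (columns_append _ _) f).trans (or_congr ?_ ?_)
  · exact mem_columns_appendRow.trans (by simp [hlt])
  · exact mem_columns_appendRow.trans
      (exists_congr fun x => and_iff_right (by simpa using hrange x))

theorem mem_columns_step_of_lt (hr : 2 ≤ r) (hri : s - i + 1 < r) (hrs : r ≤ s)
    {f : ℕ → ZMod (p ^ r)} :
    f ∈ columns ((step p s i A).block r) ↔ ∃ a < p ^ (s - i + 1), ∃ g ∈ columns (A.block r),
      g + Pi.single A.rows ((p : ZMod (p ^ r)) ^ (r - (s - i + 1)) * (a : ZMod (p ^ r))) = f := by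
  have hblock : (step p s i A).block r =
      appendRow (A.block r) ((List.range (p ^ (s - i + 1))).map fun c =>
        (p : ZMod (p ^ r)) ^ (r - (s - i + 1)) * (c : ZMod (p ^ r))) :=
    (if_neg (by omega)).trans ((if_neg (by omega)).trans (if_pos ⟨hri, hrs⟩))
  rw [hblock]
  exact mem_columns_appendRow.trans (by simp)

theorem columns_block_subset_step [NeZero p] (hr : 1 ≤ r) (hrs : r ≤ s) :
    columns (A.block r) ⊆ columns ((step p s i A).block r) := by
  intro f hf
  rcases hr.eq_or_lt with rfl | hr
  · exact mem_columns_step_one.2 ⟨0, NeZero.pos p, f, hf, by simp⟩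
  · by_cases hri : r ≤ s - i + 1
    · exact (mem_columns_step_of_le hr hri).2 (Or.inr ⟨0, f, hf, by simp⟩)
    · exact (mem_columns_step_of_lt hr (not_le.1 hri) hrs).2 ⟨0, NeZero.pos _, f, hf, by simp⟩

theorem single_add_single_mem_columns_step (hp : 2 ≤ p) (hr : 2 ≤ r) (hri : r ≤ s - i + 1)
    (hA : A.rows ≠ 0) :
    Pi.single 0 ((p : ZMod (p ^ r)) ^ (r - 1)) + Pi.single A.rows 1 ∈
      columns ((step p s i A).block r) := by
  have : NeZero p := ⟨by omega⟩
  refine (mem_columns_step_of_le hr hri).2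
    (Or.inl ⟨1, ⟨le_rfl, hp⟩, _, single_mem_columns_tuples _ ?_ hA, by simp⟩)
  have hpos : 0 < p ^ (r - 1) := NeZero.pos _
  simpa using ⟨0, hpos, by simp⟩

end StepColumns

/-- The matrix obtained from `base p s` by applying `step p s i` for the successive entries `i` of
a list, in any order. -/
def fromSteps (p s : ℕ) (l : List ℕ) : GenMatrix p :=
  l.foldl (fun A i => step p s i A) (base p s)

section FromSteps

variable {p s : ℕ}

theorem fromSteps_append_singleton (l : List ℕ) (i : ℕ) :
    fromSteps p s (l ++ [i]) = step p s i (fromSteps p s l) :=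
  List.foldl_concat ..

theorem rows_fromSteps (l : List ℕ) : (fromSteps p s l).rows = l.length + 2 := by
  induction l using List.reverseRecOn with
  | nil => rfl
  | append_singleton l i ih =>
    rw [fromSteps_append_singleton, List.length_append, List.length_singleton, add_right_comm, ← ih]
    rfl

theorem columns_block_fromSteps_subset_append [NeZero p] {r : ℕ} (hr : 1 ≤ r) (hrs : r ≤ s)
    (l l' : List ℕ) : columns ((fromSteps p s l).block r) ⊆
      columns ((fromSteps p s (l ++ l')).block r) := by
  induction l' using List.reverseRecOn with
  | nil => rw [List.append_nil]
  | append_singleton l' i ih =>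
    rw [← List.append_assoc, fromSteps_append_singleton]
    exact ih.trans (columns_block_subset_step hr hrs)

/-- The indices of the steps that lead from `base p s` to `ofType p s t`, in order. -/
def stepIndices (s : ℕ) (t : ℕ → ℕ) : List ℕ :=
  (List.range' 1 s).flatMap fun i => List.replicate (numSteps s t i) i

theorem ofType_eq_fromSteps (p s : ℕ) (t : ℕ → ℕ) :
    ofType p s t = fromSteps p s (stepIndices s t) := by
  rw [fromSteps, stepIndices, List.foldl_flatMap, ofType]
  congr
  funext A i
  generalize numSteps s t i = n
  induction n generalizing A with
  | zero => rfl
  | succ n ih => rw [Function.iterate_succ_apply, ih, List.replicate_succ, List.foldl_cons]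

theorem forall_mem_stepIndices_le_iff (hs : 2 ≤ s) {t : ℕ → ℕ} (ht : 1 ≤ t 1) :
    (∀ i ∈ stepIndices s t, s ≤ i) ↔ t 1 = 1 ∧ ∀ i, 1 < i → i < s → t i = 0 := by
  have hmem : ∀ i, i ∈ stepIndices s t ↔ 1 ≤ i ∧ i ≤ s ∧ numSteps s t i ≠ 0 := by
    intro i
    simp only [stepIndices, List.mem_flatMap, List.mem_range'_1, List.mem_replicate]
    grind
  simp only [hmem, numSteps]
  grind

end FromSteps

section GrayCode

variable {p s : ℕ} {A : GenMatrix p}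

/-- The Gray image of the additive code generated by `A`, so that
`codeH p s t = (ofType p s t).grayCode s`. -/
def grayCode (A : GenMatrix p) (s : ℕ) : Set (A.Coord s → ZMod p) :=
  A.grayMap s '' (A.additiveCode s : Set (A.Word s))

theorem row_mem_additiveCode (k : Fin A.rows) : A.row s k ∈ A.additiveCode s :=
  AddSubgroup.subset_closure ⟨k, rfl⟩

/-- The words whose coordinates over `ℤ / p ^ r` are multiples of `p ^ (r - 1)`, for each `r`. The
Gray map is additive when one of the summands is such a word. -/
def topWords (A : GenMatrix p) (s : ℕ) : AddSubgroup (A.Word s) :=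
  AddSubgroup.pi Set.univ fun r => AddSubgroup.pi Set.univ fun _ =>
    AddSubgroup.zmultiples ((p : ZMod (p ^ (r : ℕ))) ^ ((r : ℕ) - 1))

theorem mem_topWords {w : A.Word s} : w ∈ A.topWords s ↔
    ∀ (r : Finset.Icc 1 s) j,
      w r j ∈ AddSubgroup.zmultiples ((p : ZMod (p ^ (r : ℕ))) ^ ((r : ℕ) - 1)) := by
  simp only [topWords, AddSubgroup.mem_pi, Set.mem_univ, true_imp_iff]

variable [NeZero p]

theorem grayMap_add_of_mem_topWords (x : A.Word s) {w : A.Word s} (hw : w ∈ A.topWords s) :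
    A.grayMap s (x + w) = A.grayMap s x + A.grayMap s w :=
  funext fun ⟨r, j, y⟩ =>
    gray_add_of_mem_zmultiples (Finset.mem_Icc.1 r.2).1 (x r j) (mem_topWords.1 hw r j) y

theorem exists_grayMap_nsmul_eq_add {e : A.Word s} (he : ∀ r j, e r j = 0 ∨ e r j = 1)
    (m n : ℕ) :
    ∃ k : ℕ, A.grayMap s (k • e) = A.grayMap s (m • e) + A.grayMap s (n • e) := by
  obtain ⟨k, -, hk⟩ := exists_lt_digit_eq s fun i => digit p m i + digit p n i
  refine ⟨k, funext fun ⟨r, j, y⟩ => ?_⟩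
  have hr := Finset.mem_Icc.1 r.2
  change gray p r (k • e r j) y = gray p r (m • e r j) y + gray p r (n • e r j) y
  rcases he r j with h | h
  · simp only [h, smul_zero, gray_zero, add_zero]
  · simp only [h, nsmul_one]
    exact gray_natCast_add_of_digit_eq_add hr.1 (fun i hi => hk i (hi.trans_le hr.2)) y

theorem isLinearCode_image_grayMap_zmultiples_sup {e : A.Word s}
    (he : ∀ r j, e r j = 0 ∨ e r j = 1) {D : AddSubgroup (A.Word s)} (hD : D ≤ A.topWords s) :
    IsLinearCode (A.grayMap s '' (AddSubgroup.zmultiples e ⊔ D : AddSubgroup (A.Word s))) := by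
  have hgray (n : ℕ) {w : A.Word s} (hw : w ∈ D) := grayMap_add_of_mem_topWords (n • e) (hD hw)
  have hmem : ∀ z ∈ AddSubgroup.zmultiples e ⊔ D, ∃ n : ℕ, ∃ w ∈ D, n • e + w = z := by
    intro z hz
    obtain ⟨_, hy, w, hw, rfl⟩ := AddSubgroup.mem_sup.1 hz
    obtain ⟨n, rfl⟩ := mem_multiples_iff_mem_zmultiples.2 hy
    exact ⟨n, w, hw, rfl⟩
  refine isLinearCode_of_zero_mem_of_add_mem ⟨0, zero_mem _, funext fun q => gray_zero _⟩ ?_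
  rintro _ ⟨x, hx, rfl⟩ _ ⟨y, hy, rfl⟩
  obtain ⟨m, v, hv, rfl⟩ := hmem x hx
  obtain ⟨n, w, hw, rfl⟩ := hmem y hy
  obtain ⟨k, hk⟩ := exists_grayMap_nsmul_eq_add he m n
  refine ⟨k • e + (v + w), add_mem ?_ ?_, ?_⟩
  · exact AddSubgroup.mem_sup_left (nsmul_mem (AddSubgroup.mem_zmultiples e) k)
  · exact AddSubgroup.mem_sup_right (add_mem hv hw)
  · rw [hgray k (add_mem hv hw), grayMap_add_of_mem_topWords v (hD hw), hgray m hv, hgray n hw, hk]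
    abel

theorem isLinearCode_grayCode_of_row_mem_topWords {k₀ : Fin A.rows}
    (he : ∀ r j, A.row s k₀ r j = 0 ∨ A.row s k₀ r j = 1)
    (htop : ∀ k ≠ k₀, A.row s k ∈ A.topWords s) : IsLinearCode (A.grayCode s) := by
  have hcode : A.additiveCode s =
      AddSubgroup.zmultiples (A.row s k₀) ⊔ AddSubgroup.closure (A.row s '' {k₀}ᶜ) := by
    rw [additiveCode, ← Set.image_univ, ← Set.union_compl_self {k₀}, Set.image_union,
      Set.image_singleton, AddSubgroup.closure_union, AddSubgroup.zmultiples_eq_closure]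
  rw [grayCode, hcode]
  refine isLinearCode_image_grayMap_zmultiples_sup he ((AddSubgroup.closure_le _).2 ?_)
  rintro _ ⟨k, hk, rfl⟩
  exact htop k hk

end GrayCode

section Flat

variable {s : ℕ}

/-- In the blocks `1, …, s` of `A`, the second row (index `1`) has entries `0` and `1`, and every
other row has entries that are multiples of `p ^ (r - 1)`. This makes the Gray image of the code
linear. -/
def IsFlat {p : ℕ} (s : ℕ) (A : GenMatrix p) : Prop :=
  ∀ r, 1 ≤ r → r ≤ s → ∀ f ∈ columns (A.block r), (f 1 = 0 ∨ f 1 = 1) ∧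
    ∀ k ≠ 1, f k ∈ AddSubgroup.zmultiples ((p : ZMod (p ^ r)) ^ (r - 1))

theorem IsFlat.isLinearCode {p : ℕ} [NeZero p] {A : GenMatrix p} (hA : IsFlat s A)
    (hrows : 1 < A.rows) : IsLinearCode (A.grayCode s) := by
  have hcol (r : Finset.Icc 1 s) := hA r (Finset.mem_Icc.1 r.2).1 (Finset.mem_Icc.1 r.2).2
  refine isLinearCode_grayCode_of_row_mem_topWords (k₀ := ⟨1, hrows⟩) (fun r j => ?_)
    fun k hk => mem_topWords.2 fun r j => ?_
  · obtain ⟨f, hf, hrow⟩ := row_mem_columns r j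
    rw [hrow]
    exact (hcol r f hf).1
  · obtain ⟨f, hf, hrow⟩ := row_mem_columns r j
    rw [hrow]
    exact (hcol r f hf).2 k fun h => hk (Fin.ext h)

theorem isFlat_base_two (s : ℕ) : IsFlat s (base 2 s) := by
  intro r hr hrs f hf
  rcases hr.eq_or_lt with rfl | hr
  · obtain ⟨a, ha, rfl⟩ := mem_columns_base_one.1 hf
    refine ⟨?_, fun k _ => by simpa using mem_zmultiples_one _⟩
    interval_cases a <;> simp
  · obtain ⟨a, ha, rfl⟩ := (mem_columns_base hr hrs).1 hf
    obtain rfl : a = 1 := by omega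
    refine ⟨by simp, fun k hk => ?_⟩
    rw [Pi.add_apply, Pi.single_eq_of_ne hk, add_zero]
    rcases eq_or_ne k 0 with rfl | hk0
    · simp
    · simp [Pi.single_eq_of_ne hk0]

theorem exists_eq_add_single_of_mem_columns_step {p i r : ℕ} {A : GenMatrix p} (hi : s ≤ i)
    (hr : 1 ≤ r) (hrs : r ≤ s) {f : ℕ → ZMod (p ^ r)}
    (hf : f ∈ columns ((step p s i A).block r)) :
    ∃ g ∈ columns (A.block r), ∃ x ∈ AddSubgroup.zmultiples ((p : ZMod (p ^ r)) ^ (r - 1)),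
      g + Pi.single A.rows x = f := by
  rcases hr.eq_or_lt with rfl | hr
  · obtain ⟨a, -, g, hg, rfl⟩ := mem_columns_step_one.1 hf
    exact ⟨g, hg, a, by simpa using mem_zmultiples_one _, rfl⟩
  · obtain ⟨a, -, g, hg, rfl⟩ := (mem_columns_step_of_lt hr (by omega) hrs).1 hf
    refine ⟨g, hg, _, ⟨a, ?_⟩, rfl⟩
    simp [Nat.sub_eq_zero_of_le hi, mul_comm]

theorem IsFlat.step {p i : ℕ} {A : GenMatrix p} (hA : IsFlat s A) (hrows : 1 < A.rows)
    (hi : s ≤ i) : IsFlat s (step p s i A) := by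
  intro r hr hrs f hf
  obtain ⟨g, hg, x, hx, rfl⟩ := exists_eq_add_single_of_mem_columns_step hi hr hrs hf
  obtain ⟨hg1, hgtop⟩ := hA r hr hrs g hg
  refine ⟨by rwa [Pi.add_apply, Pi.single_eq_of_ne hrows.ne, add_zero], fun k hk => ?_⟩
  refine add_mem (hgtop k hk) ?_
  rcases eq_or_ne k A.rows with rfl | hne
  · rwa [Pi.single_eq_same]
  · rw [Pi.single_eq_of_ne hne]
    exact zero_mem _

theorem isFlat_fromSteps_two {l : List ℕ} (hl : ∀ i ∈ l, s ≤ i) : IsFlat s (fromSteps 2 s l) := by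
  induction l using List.reverseRecOn with
  | nil => exact isFlat_base_two s
  | append_singleton l i ih =>
    rw [fromSteps_append_singleton]
    refine (ih fun j hj => hl j (List.mem_append_left _ hj)).step ?_ (hl i (by simp))
    rw [rows_fromSteps]
    omega

end Flat

section Nonlinear

variable {p s : ℕ} {A : GenMatrix p}

theorem exists_grayMap_eq_add_of_isLinearCode (hlin : IsLinearCode (A.grayCode s))
    {x y : A.Word s} (hx : x ∈ A.additiveCode s) (hy : y ∈ A.additiveCode s) :
    ∃ z ∈ A.additiveCode s, A.grayMap s z = A.grayMap s x + A.grayMap s y := by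
  obtain ⟨V, hV⟩ := hlin
  have hmem : ∀ w ∈ A.additiveCode s, A.grayMap s w ∈ V := fun w hw => by
    rw [← SetLike.mem_coe, hV]
    exact ⟨w, hw, rfl⟩
  have hsum := V.add_mem (hmem x hx) (hmem y hy)
  rwa [← SetLike.mem_coe, hV] at hsum

theorem map_eq_of_mem_additiveCode {r₁ r₂ : Finset.Icc 1 s} {a : Fin (A.block r₁).length}
    {b c d : Fin (A.block r₂).length} {ψ : ZMod (p ^ (r₁ : ℕ)) →+ ZMod (p ^ (r₂ : ℕ))}
    (hrow : ∀ k, ψ (A.row s k r₁ a) = A.row s k r₂ b + A.row s k r₂ d - A.row s k r₂ c)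
    {z : A.Word s} (hz : z ∈ A.additiveCode s) : ψ (z r₁ a) = z r₂ b + z r₂ d - z r₂ c := by
  induction hz using AddSubgroup.closure_induction with
  | mem z hz =>
    obtain ⟨k, rfl⟩ := hz
    exact hrow k
  | zero => simp
  | add u v _ _ hu hv =>
    simp only [Pi.add_apply, map_add, hu, hv]
    abel
  | neg u _ hu =>
    simp only [Pi.neg_apply, map_neg, hu]
    abel

theorem exists_gray_eq_add_of_isLinearCode [NeZero p] (hs : 2 ≤ s)
    (hlin : IsLinearCode (A.grayCode s))
    {b c d : ℕ → ZMod (p ^ 2)} (ha : Pi.single 0 1 ∈ columns (A.block 1))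
    (hb : b ∈ columns (A.block 2)) (hc : c ∈ columns (A.block 2)) (hd : d ∈ columns (A.block 2))
    (hrel : b + d = c + Pi.single 0 (p : ZMod (p ^ 2))) {k l : ℕ} (hk : k < A.rows)
    (hl : l < A.rows) (hk0 : k ≠ 0) (hl0 : l ≠ 0) (n : ℕ) :
    ∃ zb zc zd, zb + zd = zc ∧ gray p 2 zb = gray p 2 (b k) + gray p 2 (n • b l) ∧
      gray p 2 zc = gray p 2 (c k) + gray p 2 (n • c l) ∧
      gray p 2 zd = gray p 2 (d k) + gray p 2 (n • d l) := by
  have h1 : 1 ∈ Finset.Icc 1 s := Finset.mem_Icc.2 ⟨le_rfl, by omega⟩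
  have h2 : 2 ∈ Finset.Icc 1 s := Finset.mem_Icc.2 ⟨one_le_two, hs⟩
  obtain ⟨ja, hja⟩ := exists_row_eq_of_mem_columns ha h1
  obtain ⟨jb, hjb⟩ := exists_row_eq_of_mem_columns hb h2
  obtain ⟨jc, hjc⟩ := exists_row_eq_of_mem_columns hc h2
  obtain ⟨jd, hjd⟩ := exists_row_eq_of_mem_columns hd h2
  have hpp : p ^ 1 • (p : ZMod (p ^ 2)) = 0 := by
    rw [pow_one, nsmul_eq_mul, ← sq, ← Nat.cast_pow, ZMod.natCast_self]
  obtain ⟨ψ, hψ⟩ := exists_addMonoidHom_one_eq hpp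
  have hrow : ∀ k, ψ (A.row s k ⟨1, h1⟩ ja) =
      A.row s k ⟨2, h2⟩ jb + A.row s k ⟨2, h2⟩ jd - A.row s k ⟨2, h2⟩ jc := by
    intro k
    rw [hja, hjb, hjc, hjd, ← Pi.add_apply b d, hrel, Pi.add_apply, add_sub_cancel_left,
      Pi.apply_single (fun _ => ψ) (fun _ => map_zero ψ), hψ]
  obtain ⟨z, hz, hgray⟩ := exists_grayMap_eq_add_of_isLinearCode hlin
    (row_mem_additiveCode ⟨k, hk⟩) (nsmul_mem (row_mem_additiveCode ⟨l, hl⟩) n)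
  have hcoord (r : Finset.Icc 1 s) (j) : gray p r (z r j) =
      gray p r (A.row s ⟨k, hk⟩ r j) + gray p r (n • A.row s ⟨l, hl⟩ r j) :=
    funext fun y => congrFun hgray ⟨r, j, y⟩
  have hza : z ⟨1, h1⟩ ja = 0 := by
    refine gray_injective ((hcoord _ _).trans (funext fun y => ?_))
    rw [hja, hja, Pi.single_eq_of_ne hk0, Pi.single_eq_of_ne hl0, smul_zero, Pi.add_apply,
      gray_zero, add_zero]
  refine ⟨z ⟨2, h2⟩ jb, z ⟨2, h2⟩ jc, z ⟨2, h2⟩ jd, ?_, ?_, ?_, ?_⟩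
  · have hsum := map_eq_of_mem_additiveCode (r₁ := ⟨1, h1⟩) (r₂ := ⟨2, h2⟩) (a := ja) (b := jb)
      (c := jc) (d := jd) (ψ := ψ) hrow hz
    rw [hza, map_zero] at hsum
    exact sub_eq_zero.1 hsum.symm
  · rw [← hjb ⟨k, hk⟩, ← hjb ⟨l, hl⟩]
    exact hcoord ⟨2, h2⟩ jb
  · rw [← hjc ⟨k, hk⟩, ← hjc ⟨l, hl⟩]
    exact hcoord ⟨2, h2⟩ jc
  · rw [← hjd ⟨k, hk⟩, ← hjd ⟨l, hl⟩]
    exact hcoord ⟨2, h2⟩ jd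

theorem not_isLinearCode_grayCode_of_mem_columns (hp : 2 ≤ p) (hs : 2 ≤ s) {n : ℕ}
    (hn : 1 < n) (hrows : n < A.rows) (ha : Pi.single 0 1 ∈ columns (A.block 1))
    (hb : Pi.single 0 (p : ZMod (p ^ 2)) + Pi.single 1 1 ∈ columns (A.block 2))
    (hc : Pi.single 0 (p : ZMod (p ^ 2)) + Pi.single 1 1 + Pi.single n 1 ∈ columns (A.block 2))
    (hd : Pi.single 0 (p : ZMod (p ^ 2)) + Pi.single n 1 ∈ columns (A.block 2)) :
    ¬IsLinearCode (A.grayCode s) := by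
  have : NeZero p := ⟨by omega⟩
  intro hlin
  obtain ⟨zb, zc, zd, hsum, hzb, hzc, hzd⟩ := exists_gray_eq_add_of_isLinearCode hs hlin ha hb hc
    hd (by abel) hrows (hn.trans hrows) (by omega) one_ne_zero (p - 1)
  have hzero : gray p 2 0 = 0 := gray_two_eq_zero_iff.2 rfl
  simp only [Pi.add_apply, Pi.single_apply, show n ≠ 0 by omega, hn.ne, hn.ne', one_ne_zero,
    if_true, if_false, zero_add, add_zero, smul_zero, nsmul_one, hzero] at hzb hzc hzd
  obtain rfl := gray_injective hzb
  obtain rfl := gray_two_eq_zero_iff.1 (hzc.trans (gray_two_one_add_gray_two_sub_one hp))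
  obtain rfl := gray_injective hzd
  refine natCast_zmod_sq_ne_zero hp ?_
  rwa [← Nat.cast_add_one, Nat.sub_add_cancel (by omega)] at hsum

theorem not_isLinearCode_grayCode_of_three_le (hp : 3 ≤ p) (hs : 2 ≤ s) (hrows : 1 < A.rows)
    (ha : Pi.single 0 1 ∈ columns (A.block 1))
    (hb : Pi.single 0 (p : ZMod (p ^ 2)) + Pi.single 1 1 ∈ columns (A.block 2))
    (hc : Pi.single 0 (p : ZMod (p ^ 2)) + Pi.single 1 2 ∈ columns (A.block 2)) :
    ¬IsLinearCode (A.grayCode s) := by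
  have : NeZero p := ⟨by omega⟩
  intro hlin
  have htwo : (Pi.single 1 2 : ℕ → ZMod (p ^ 2)) = Pi.single 1 1 + Pi.single 1 1 := by
    rw [← Pi.single_add, one_add_one_eq_two]
  obtain ⟨zb, zc, zd, hsum, hzb, hzc, hzd⟩ := exists_gray_eq_add_of_isLinearCode hs hlin ha hb hc
    hb (by rw [htwo]; abel) hrows hrows one_ne_zero one_ne_zero (p - 1)
  simp only [Pi.add_apply, Pi.single_eq_same, Pi.single_eq_of_ne one_ne_zero, zero_add,
    nsmul_eq_mul, mul_one] at hzb hzc hzd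
  obtain rfl := gray_two_eq_zero_iff.1 (hzb.trans (gray_two_one_add_gray_two_sub_one (by omega)))
  obtain rfl := gray_two_eq_zero_iff.1 (hzd.trans (gray_two_one_add_gray_two_sub_one (by omega)))
  obtain rfl := gray_injective (hzc.trans (gray_two_two_add_gray_two_mul_two (by omega)))
  refine natCast_zmod_sq_ne_zero (by omega : 2 ≤ p) ?_
  rw [← hsum, add_zero]

end Nonlinear

section NonlinearSteps

variable {p s : ℕ}

theorem single_mem_columns_fromSteps_one [NeZero p] (hs : 1 ≤ s) (l : List ℕ) :
    Pi.single 0 1 ∈ columns ((fromSteps p s l).block 1) :=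
  columns_block_fromSteps_subset_append le_rfl hs [] l
    (mem_columns_base_one.2 ⟨0, NeZero.pos p, by simp⟩)

theorem single_add_single_mem_columns_fromSteps_two [NeZero p] (hs : 2 ≤ s) (l : List ℕ) {a : ℕ}
    (ha : 1 ≤ a) (hap : a < p) :
    Pi.single 0 (p : ZMod (p ^ 2)) + Pi.single 1 (a : ZMod (p ^ 2)) ∈
      columns ((fromSteps p s l).block 2) :=
  columns_block_fromSteps_subset_append one_le_two hs [] l
    ((mem_columns_base le_rfl hs).2 ⟨a, ⟨ha, hap⟩, by simp⟩)

theorem not_isLinearCode_grayCode_fromSteps_of_mem_of_lt (hp : 2 ≤ p) (hs : 2 ≤ s) {l : List ℕ}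
    {i : ℕ} (hil : i ∈ l) (his : i < s) : ¬IsLinearCode ((fromSteps p s l).grayCode s) := by
  have : NeZero p := ⟨by omega⟩
  obtain ⟨l₁, l₂, rfl⟩ := List.append_of_mem hil
  have hstep : columns ((step p s i (fromSteps p s l₁)).block 2) ⊆
      columns ((fromSteps p s (l₁ ++ i :: l₂)).block 2) := by
    rw [← fromSteps_append_singleton, List.append_cons l₁ i l₂]
    exact columns_block_fromSteps_subset_append one_le_two hs _ _
  have hb (l : List ℕ) : Pi.single 0 (p : ZMod (p ^ 2)) + Pi.single 1 1 ∈
      columns ((fromSteps p s l).block 2) := by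
    simpa only [Nat.cast_one] using single_add_single_mem_columns_fromSteps_two hs l le_rfl hp
  have hc := hstep ((mem_columns_step_of_le le_rfl (by omega)).2 (Or.inr ⟨1, _, hb l₁, rfl⟩))
  have hd := hstep (single_add_single_mem_columns_step hp le_rfl (by omega)
    (by rw [rows_fromSteps]; omega))
  rw [pow_one] at hd
  refine not_isLinearCode_grayCode_of_mem_columns hp hs ?_ ?_
    (single_mem_columns_fromSteps_one (by omega) _) (hb _) hc hd
  · rw [rows_fromSteps]
    omega
  · rw [rows_fromSteps, rows_fromSteps, List.length_append, List.length_cons]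
    omega

theorem not_isLinearCode_grayCode_fromSteps_of_three_le (hp : 3 ≤ p) (hs : 2 ≤ s) (l : List ℕ) :
    ¬IsLinearCode ((fromSteps p s l).grayCode s) := by
  have : NeZero p := ⟨by omega⟩
  have hb := single_add_single_mem_columns_fromSteps_two hs l le_rfl (by omega : 1 < p)
  have hc := single_add_single_mem_columns_fromSteps_two hs l one_le_two (by omega : 2 < p)
  rw [Nat.cast_one] at hb
  rw [Nat.cast_two] at hc
  refine not_isLinearCode_grayCode_of_three_le hp hs ?_
    (single_mem_columns_fromSteps_one (by omega) l) hb hc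
  rw [rows_fromSteps]
  omega

end NonlinearSteps

end GenMatrix

open GenMatrix in
theorem theorem2_general {p s : ℕ} (hp : 2 ≤ p) (hs : 2 ≤ s) (l : List ℕ) :
    IsLinearCode ((fromSteps p s l).grayCode s) ↔ p = 2 ∧ ∀ i ∈ l, s ≤ i := by
  refine ⟨fun hlin => ⟨?_, fun i hi => ?_⟩, ?_⟩
  · by_contra hp2
    exact not_isLinearCode_grayCode_fromSteps_of_three_le (by omega) hs l hlin
  · by_contra! his
    exact not_isLinearCode_grayCode_fromSteps_of_mem_of_lt hp hs hi his hlin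
  · rintro ⟨rfl, hl⟩
    refine (isFlat_fromSteps_two hl).isLinearCode ?_
    rw [rows_fromSteps]
    omega

/-- Among the codes `H_2^{t₁,…,t_s}` (`s ≥ 2`, `t₁ ≥ 1`, `t₂, …, t_{s-1} ≥ 0`, `t_s ≥ 1`), exactly
the codes `H_2^{1,0,…,0,t_s}` are linear over `ℤ_2`. -/
theorem theorem2 (s : ℕ) (hs : 2 ≤ s) (t : ℕ → ℕ) (ht_first : 1 ≤ t 1) (ht_last : 1 ≤ t s) :
    IsLinearCode (codeH 2 s t) ↔ (t 1 = 1 ∧ ∀ i : ℕ, 1 < i → i < s → t i = 0) := by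
  change IsLinearCode ((GenMatrix.ofType 2 s t).grayCode s) ↔ _
  rw [GenMatrix.ofType_eq_fromSteps, theorem2_general le_rfl hs,
    ← GenMatrix.forall_mem_stepIndices_le_iff hs ht_first, and_iff_right rfl]
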